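/- Let $K$ be an infinite field of any characteristic, let $R=K[x_1,\ldots,x_n]$ be the polynomial ring with the standard grading, $\mathfrak m=(x_1,\ldots,x_n)$, and let $I$ be a graded (homogeneous) ideal of $R$. Let $X_1,\ldots,X_n$ be indeterminates over $R$, let $R'$ be the localization of $R[X_1,\ldots,X_n]$ at the prime ideal $\mathfrak m R[X_1,\ldots,X_n]$, and put $Y=X_1x_1+\cdots+X_nx_n\in R'$. Write $l(M)\in\mathbb N\cup\{\infty\}$ for the length of a module $M$; lengths of $R'$-modules are taken over $R'$, and lengths of $R$-modules over $R$. Then: 1. $l\big((IR':_{R'}Y)/IR'\big)$ is finite. 2. $l\big((IR':_{R'}Y)/IR'\big)\le l\big((I:_Ry)/I\big)$ for every linear form $y\in R$. 3. $l\big((IR':_{R'}Y)/IR'\big)= l\big((I:_Ry)/I\big)$ for a general linear form $y\in R$, that is, there is a nonempty Zariski open subset $U\subseteq K^n$ such that the equality holds for $y=a_1x_1+\cdots+a_nx_n$ whenever $(a_1,\ldots,a_n)\in U$. Consequently, the $t$-value $t(I):=l\big((IR':_{R'}Y)/IR'\big)$ satisfies $$t(I)=\min\{\,l((I:_Ry)/I)\mid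 y \text{ a linear form of } R\,\}.$$ -/

import Mathlib

open MvPolynomial

attribute [local instance] MvPolynomial.gradedAlgebra

namespace TValue

noncomputable section

/-- The length of the `A`-module `(I : y) / I`, an element of `ℕ ∪ {∞}`. -/
def colonLength {A : Type*} [CommRing A] (I : Ideal A) (y : A) : ℕ∞ :=
  Module.length A (↥(I.colon {y}) ⧸ Submodule.submoduleOf I (I.colon {y}))

/-- The polynomial ring `R = K[x₁, …, xₙ]`. -/
abbrev R (K : Type*) [Field K] (n : ℕ) : Type _ := MvPolynomial (Fin n) K

/-- The ideal `𝔪 = (x₁, …, xₙ)` of `R`. -/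
def maxIdeal (K : Type*) [Field K] (n : ℕ) : Ideal (R K n) :=
  Ideal.span (Set.range (X : Fin n → R K n))

/-- The polynomial ring `S = R[X₁, …, Xₙ]`, whose coefficient ring is `R`. -/
abbrev S (K : Type*) [Field K] (n : ℕ) : Type _ := MvPolynomial (Fin n) (R K n)

/-- The extension `𝔪S` of `𝔪` to `S`. -/
def maxIdealExt (K : Type*) [Field K] (n : ℕ) : Ideal (S K n) :=
  (maxIdeal K n).map (C : R K n →+* S K n)

theorem maxIdeal_eq_ker (K : Type*) [Field K] (n : ℕ) :
    maxIdeal K n = RingHom.ker (constantCoeff : R K n →+* K) := by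
  ext p
  rw [RingHom.mem_ker, maxIdeal, ← Set.image_univ, mem_ideal_span_X_image]
  constructor
  · intro h
    by_contra hp
    obtain ⟨i, -, hi⟩ := h 0 (by rwa [mem_support_iff, ← constantCoeff_eq])
    exact hi rfl
  · intro h m hm
    by_contra! hc
    have h0 : m = 0 := by
      ext i
      exact hc i (Set.mem_univ i)
    subst h0
    exact mem_support_iff.mp hm h

instance maxIdealExt_isPrime (K : Type*) [Field K] (n : ℕ) : (maxIdealExt K n).IsPrime := by
  rw [maxIdealExt, maxIdeal_eq_ker, ← ker_map]
  exact RingHom.ker_isPrime _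

/-- The ring `R'`, the localization of `S` at the prime ideal `𝔪S`. -/
abbrev R' (K : Type*) [Field K] (n : ℕ) : Type _ := Localization.AtPrime (maxIdealExt K n)

/-- The extension `IR'` of an ideal `I` of `R`. -/
def extIdeal {K : Type*} [Field K] {n : ℕ} (I : Ideal (R K n)) : Ideal (R' K n) :=
  I.map ((algebraMap (S K n) (R' K n)).comp (C : R K n →+* S K n))

/-- The generic linear form `Y = X₁x₁ + ⋯ + Xₙxₙ` in `R'`. -/
def genericForm (K : Type*) [Field K] (n : ℕ) : R' K n :=
  algebraMap (S K n) (R' K n) (∑ i : Fin n, (X i : S K n) * C (X i : R K n))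

/-- The `t`-value `t(I)`, the length of `(IR' : Y) / IR'` over `R'`. -/
def tValue {K : Type*} [Field K] {n : ℕ} (I : Ideal (R K n)) : ℕ∞ :=
  colonLength (extIdeal I) (genericForm K n)

/-- The linear form `a₁x₁ + ⋯ + aₙxₙ` of `R` with coefficient vector `a ∈ Kⁿ`. -/
def linForm {K : Type*} [Field K] {n : ℕ} (a : Fin n → K) : R K n :=
  ∑ i : Fin n, C (a i) * X i

/-- A property holds for a general linear form of `R` if it holds for all `a₁x₁ + ⋯ + aₙxₙ` with
`(a₁, …, aₙ)` in some nonempty Zariski open subset `U` of the affine space `Kⁿ`. Such a `U` is the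
complement of the zero locus in `Kⁿ` of some ideal `J`. -/
def ForGeneralLinearForm {K : Type*} [Field K] {n : ℕ} (P : R K n → Prop) : Prop :=
  ∃ J : Ideal (MvPolynomial (Fin n) K), (zeroLocus K J)ᶜ.Nonempty ∧
    ∀ a ∈ (zeroLocus K J)ᶜ, P (linForm a)

end

end TValue

/-! `R'` is the localization of `T = K(X)[x]` at the ideal `m` of the variables `x`, and `Y` is a
linear form of `T`; so `t(I)` can be computed in `T` once a power of `m` is known to kill `(IT :
Y)/IT`.

Over any field and for homogeneous `J`, let `l_D(y)` be the length of the part of `(J : y)/J` in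
degrees below `D`. Multiplication by `y` expresses `l_D(y)` through the lengths of the quotients by
`J + m^D`, `J + m^(D+1)` and `J + (y) + m^(D+1)` (`relLength_colon_add`). Only the last involves
`y`, and it is the corank of a matrix of coefficients (`length_quotient_span_add_rank`), which for
`Y` has entries in `K[X]`. Under `X ↦ a` the rank cannot rise, and it is kept where a suitable minor
does not vanish. So the generic `l_D` bounds the special ones from below, with equality on an open
set (`truncatedLength_le`, `exists_truncatedLength_eq`).

It remains to bound `D`. Primary decomposition over `K` gives one `D₀` with `(I : y) ∩ m^D₀ ⊆ I` for
general `y` (`exists_colon_linForm_inf_pow_le`), so the special `l_D` are constant from `D₀` on.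
Comparison at a general point makes the generic `l_D` constant too, and `t(I)` is the finite generic
`l_D₀`. -/

namespace TValue

/-! ### Lengths of colon quotients and their behaviour under localization -/

section Length

variable {A : Type*} [CommRing A]

/-- The length of `b / (a ⊓ b)`. -/
noncomputable def relLength (a b : Ideal A) : ℕ∞ :=
  Module.length A (↥b ⧸ Submodule.submoduleOf a b)

theorem colonLength_eq_relLength (I : Ideal A) (y : A) :
    colonLength I y = relLength I (I.colon {y}) := rfl

theorem relLength_add_length_quotient {a b : Ideal A} (h : a ≤ b) :
    relLength a b + Module.length A (A ⧸ b) = Module.length A (A ⧸ a) := by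
  symm
  refine Module.length_eq_add_of_exact
    (Submodule.mapQ (Submodule.submoduleOf a b) a b.subtype le_rfl)
    (Submodule.factor h) ?_ (Submodule.factor_surjective h) ?_
  · rw [← LinearMap.ker_eq_bot]
    refine Submodule.ker_liftQ_eq_bot' _ _ ?_
    rw [LinearMap.ker_comp, Submodule.ker_mkQ]; rfl
  · intro x
    obtain ⟨x, rfl⟩ := Submodule.mkQ_surjective a x
    constructor
    · intro hx
      have hx' : x ∈ b := (Submodule.Quotient.mk_eq_zero b).mp hx
      exact ⟨Submodule.Quotient.mk ⟨x, hx'⟩, rfl⟩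
    · rintro ⟨z, hz⟩
      obtain ⟨z, rfl⟩ := Submodule.mkQ_surjective _ z
      rw [← hz]
      exact (Submodule.Quotient.mk_eq_zero b).mpr z.2

theorem relLength_anti_left {a a' : Ideal A} (h : a ≤ a') (b : Ideal A) :
    relLength a' b ≤ relLength a b :=
  Module.length_le_of_surjective (Submodule.factor (Submodule.comap_mono h))
    (Submodule.factor_surjective _)

theorem relLength_inf_left (a b : Ideal A) : relLength (a ⊓ b) b = relLength a b := by
  have : Submodule.submoduleOf (a ⊓ b) b = Submodule.submoduleOf a b := by
    ext x; simp [Submodule.submoduleOf]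
  rw [relLength, this, relLength]

theorem relLength_sup_right (a b : Ideal A) : relLength a (b ⊔ a) = relLength a b := by
  rw [← relLength_inf_left, relLength, relLength]
  have h := (LinearMap.quotientInfEquivSupQuotient b a).length_eq
  rw [inf_eq_left.mpr le_sup_right]
  refine h.symm.trans ?_
  rw [Submodule.comap_subtype_self, top_inf_eq, Submodule.submoduleOf]

/-- Multiplication by `y` gives an exact sequence `0 → A/(c : y) → A/c → A/(c + (y)) → 0`. -/
theorem length_quotient_colon_add (c : Ideal A) (y : A) :
    Module.length A (A ⧸ c.colon {y}) + Module.length A (A ⧸ (c ⊔ Ideal.span {y})) =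
      Module.length A (A ⧸ c) := by
  symm
  have hle : c.colon {y} = Submodule.comap (LinearMap.mulRight A y) c := by
    ext x; simp [Submodule.mem_colon_singleton]
  refine Module.length_eq_add_of_exact
    (Submodule.mapQ (c.colon {y}) c (LinearMap.mulRight A y) hle.le)
    (Submodule.factor le_sup_left) ?_ (Submodule.factor_surjective le_sup_left) ?_
  · rw [← LinearMap.ker_eq_bot]
    refine Submodule.ker_liftQ_eq_bot' _ _ ?_
    rw [LinearMap.ker_comp, Submodule.ker_mkQ, hle]
  · intro x
    obtain ⟨x, rfl⟩ := Submodule.mkQ_surjective c x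
    constructor
    · intro hx
      have hx' : x ∈ c ⊔ Ideal.span {y} := (Submodule.Quotient.mk_eq_zero _).mp hx
      obtain ⟨u, hu, v, hv, rfl⟩ := Submodule.mem_sup.mp hx'
      obtain ⟨w, rfl⟩ := Ideal.mem_span_singleton'.mp hv
      refine ⟨Submodule.Quotient.mk w, ?_⟩
      simp only [Submodule.mapQ_apply, LinearMap.mulRight_apply, Submodule.mkQ_apply]
      rw [Submodule.Quotient.eq]
      simpa using hu
    · rintro ⟨z, hz⟩
      obtain ⟨z, rfl⟩ := Submodule.mkQ_surjective _ z
      rw [← hz]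
      refine (Submodule.Quotient.mk_eq_zero (c ⊔ Ideal.span {y})).mpr ?_
      exact Ideal.mem_sup_right (Ideal.mul_mem_left _ _ (Ideal.mem_span_singleton_self y))

/-- The surjection from `b/(a ⊓ b)` to `b/(a' ⊓ b)` has a kernel of length zero, by cancellation of
finite lengths. -/
theorem inf_le_of_relLength_eq {a a' b : Ideal A} (h : a ≤ a')
    (heq : relLength a b = relLength a' b) (hfin : relLength a b ≠ ⊤) : a' ⊓ b ≤ a := by
  have hle : Submodule.submoduleOf a b ≤ Submodule.submoduleOf a' b := Submodule.comap_mono h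
  have key := Module.length_eq_add_of_exact (LinearMap.ker (Submodule.factor hle)).subtype
    (Submodule.factor hle) (Submodule.subtype_injective _) (Submodule.factor_surjective _)
    (LinearMap.exact_subtype_ker_map _)
  change relLength a b = _ + relLength a' b at key
  rw [heq] at key hfin
  have h0 : Module.length A (LinearMap.ker (Submodule.factor hle)) = 0 := by
    have : 0 + relLength a' b = Module.length A (LinearMap.ker (Submodule.factor hle)) +
      relLength a' b := by rw [zero_add]; exact key
    exact (WithTop.add_right_inj hfin).mp this |>.symm
  rw [Module.length_eq_zero_iff, Submodule.subsingleton_iff_eq_bot] at h0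
  rintro x ⟨hx, hxb⟩
  have : (Submodule.Quotient.mk ⟨x, hxb⟩ : b ⧸ Submodule.submoduleOf a b) ∈
      LinearMap.ker (Submodule.factor hle) := by
    exact (Submodule.Quotient.mk_eq_zero (Submodule.submoduleOf a' b)).mpr hx
  rw [h0, Submodule.mem_bot, Submodule.Quotient.mk_eq_zero] at this
  exact this

/-- The submodules of `b / a` are the ideals between `a` and `b`. -/
def submoduleQuotientOrderIso {a b : Ideal A} (h : a ≤ b) :
    Submodule A (b ⧸ Submodule.submoduleOf a b) ≃o Set.Icc a b :=
  (Submodule.comapMkQRelIso (Submodule.submoduleOf a b)).trans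
    { toFun := fun c => ⟨Submodule.map (Submodule.subtype b) c.1, by
        constructor
        · intro x hx
          exact ⟨⟨x, h hx⟩, c.2 hx, rfl⟩
        · exact Submodule.map_subtype_le _ _⟩
      invFun := fun c => ⟨Submodule.comap (Submodule.subtype b) c.1, Submodule.comap_mono c.2.1⟩
      left_inv := fun c => Subtype.ext
        (Submodule.comap_map_eq_of_injective (Submodule.subtype_injective b) _)
      right_inv := fun c => Subtype.ext (by
        refine (Submodule.map_comap_subtype _ _).trans ?_
        exact inf_eq_right.mpr c.2.2)
      map_rel_iff' := by
        intro c d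
        exact Submodule.map_le_map_iff_of_injective (Submodule.subtype_injective b) _ _ }

theorem coe_relLength {a b : Ideal A} (h : a ≤ b) :
    (relLength a b : WithBot ℕ∞) = Order.krullDim (Set.Icc a b) := by
  rw [relLength, Module.coe_length]
  exact Order.krullDim_eq_of_orderIso (submoduleQuotientOrderIso h)

theorem map_colon_singleton (M : Submonoid A) (A' : Type*) [CommRing A'] [Algebra A A']
    [IsLocalization M A'] (J : Ideal A) (y : A) :
    (J.map (algebraMap A A')).colon {algebraMap A A' y} =
      (J.colon {y}).map (algebraMap A A') := by
  apply le_antisymm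
  · intro z hz
    rw [Submodule.mem_colon_singleton, smul_eq_mul] at hz
    obtain ⟨⟨r, s⟩, hrs⟩ := IsLocalization.surj M z
    have h1 : algebraMap A A' (r * y) ∈ J.map (algebraMap A A') := by
      rw [map_mul, ← hrs, mul_right_comm]
      exact Ideal.mul_mem_right _ _ hz
    obtain ⟨u, hu, hu'⟩ := (IsLocalization.algebraMap_mem_map_algebraMap_iff M A' _ _).mp h1
    rw [IsLocalization.mem_map_algebraMap_iff M]
    refine ⟨⟨⟨u * r, ?_⟩, ⟨u * s, mul_mem hu s.2⟩⟩, ?_⟩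
    · rw [Submodule.mem_colon_singleton, smul_eq_mul, mul_assoc]; exact hu'
    · simp only [map_mul]
      rw [← hrs]; ring
  · rw [Ideal.map_le_iff_le_comap]
    intro x hx
    rw [Submodule.mem_colon_singleton, smul_eq_mul] at hx
    rw [Ideal.mem_comap, Submodule.mem_colon_singleton, smul_eq_mul, ← map_mul]
    exact Ideal.mem_map_of_mem _ hx

/-- Elements outside `p` are units modulo `p ^ k`, which kills `(J : y)/J`; so localizing leaves the
lattice of ideals between `J` and `J : y` unchanged. -/
theorem colonLength_localization (p : Ideal A) [hp : p.IsMaximal] (A' : Type*) [CommRing A']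
    [Algebra A A'] [IsLocalization.AtPrime A' p] (J : Ideal A) (y : A) (k : ℕ)
    (hk : p ^ k * J.colon {y} ≤ J) :
    colonLength (J.map (algebraMap A A')) (algebraMap A A' y) = colonLength J y := by
  rw [colonLength_eq_relLength, colonLength_eq_relLength, map_colon_singleton p.primeCompl]
  set b := J.colon {y}
  have hJb : J ≤ b := Ideal.le_colon
  rw [← WithBot.coe_inj, coe_relLength hJb, coe_relLength (Ideal.map_mono hJb)]
  have key : ∀ a : Ideal A, J ≤ a → a ≤ b →
      (a.map (algebraMap A A')).comap (algebraMap A A') ⊓ b = a := by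
    intro a ha hab
    apply le_antisymm
    · rintro x ⟨hx, hxb⟩
      obtain ⟨s, hs, hsx⟩ :=
        (IsLocalization.algebraMap_mem_map_algebraMap_iff p.primeCompl A' _ _).mp hx
      have hcop : Ideal.span {s} ⊔ p ^ k = ⊤ := by
        apply Ideal.sup_pow_eq_top
        rw [sup_comm]
        exact hp.1.2 _ (lt_of_le_of_ne le_sup_left fun he => hs (by
          rw [he]; exact Ideal.mem_sup_right (Ideal.mem_span_singleton_self s)))
      obtain ⟨u, hu, v, hv, huv⟩ := Submodule.mem_sup.mp
        (hcop ▸ Submodule.mem_top : (1 : A) ∈ Ideal.span {s} ⊔ p ^ k)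
      obtain ⟨w, rfl⟩ := Ideal.mem_span_singleton'.mp hu
      -- The first summand lies in `a` because `s * x` does, the second in `p ^ k * b ≤ J ≤ a`.
      have : x = w * (s * x) + v * x := by
        rw [← mul_assoc, ← add_mul, huv, one_mul]
      rw [this]
      exact add_mem (Ideal.mul_mem_left _ _ hsx) (ha (hk (Ideal.mul_mem_mul hv hxb)))
    · exact le_inf Ideal.le_comap_map hab
  refine (Order.krullDim_eq_of_orderIso
    { toFun := fun c => ⟨c.1.map (algebraMap A A'), Ideal.map_mono c.2.1, Ideal.map_mono c.2.2⟩
      invFun := fun c => ⟨c.1.comap (algebraMap A A') ⊓ b,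
        le_inf (Ideal.map_le_iff_le_comap.mp c.2.1) hJb, inf_le_right⟩
      left_inv := fun c => Subtype.ext (key c.1 c.2.1 c.2.2)
      right_inv := fun c => Subtype.ext (by
        dsimp only
        rw [IsLocalization.map_inf p.primeCompl, IsLocalization.map_under p.primeCompl]
        exact inf_eq_left.mpr c.2.2)
      map_rel_iff' := ?_ }).symm
  intro c d
  refine ⟨fun h => ?_, fun h => Ideal.map_mono h⟩
  change c.1 ≤ d.1
  rw [← key c.1 c.2.1 c.2.2, ← key d.1 d.2.1 d.2.2]
  exact inf_le_inf_right _ (Ideal.comap_mono h)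

end Length

/-- Each `t` acts on `N` as some scalar of `F`, so `A`-submodules and `F`-submodules coincide. -/
theorem length_eq_length_of_smul_eq_bot {F A N : Type*} [CommRing F] [CommRing A] [Algebra F A]
    [AddCommGroup N] [Module F N] [Module A N] [IsScalarTower F A N] (p : Ideal A)
    (hp : ∀ t : A, ∃ c : F, t - algebraMap F A c ∈ p)
    (h : p • (⊤ : Submodule A N) = ⊥) : Module.length A N = Module.length F N := by
  apply WithBot.coe_injective
  rw [Module.coe_length, Module.coe_length]
  refine Order.krullDim_eq_of_orderIso
    { toFun := Submodule.restrictScalars F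
      invFun := fun c => { c with
        smul_mem' := fun t x hx => by
          obtain ⟨s, hs⟩ := hp t
          have h0 : (t - algebraMap F A s) • x = 0 := by
            rw [← Submodule.mem_bot A, ← h]
            exact Submodule.smul_mem_smul hs Submodule.mem_top
          rw [sub_smul, sub_eq_zero, algebraMap_smul] at h0
          rw [h0]
          exact c.smul_mem s hx }
      left_inv := fun c => rfl
      right_inv := fun c => rfl
      map_rel_iff' := Iff.rfl }

theorem length_eq_length_of_pow_smul_eq_bot {F A : Type*} [CommRing F] [CommRing A] [Algebra F A]
    (p : Ideal A) (hp : ∀ t : A, ∃ c : F, t - algebraMap F A c ∈ p) (k : ℕ) :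
    ∀ {N : Type*} [AddCommGroup N] [Module F N] [Module A N] [IsScalarTower F A N],
      p ^ k • (⊤ : Submodule A N) = ⊥ → Module.length A N = Module.length F N := by
  induction k with
  | zero =>
    intro N _ _ _ _ h
    rw [pow_zero, Ideal.one_eq_top, Submodule.top_smul] at h
    have : Subsingleton N := (Submodule.subsingleton_iff A).mp (subsingleton_of_bot_eq_top h.symm)
    rw [Module.length_eq_zero, Module.length_eq_zero]
  | succ k ih =>
    intro N _ _ _ _ h
    set P : Submodule A N := p • ⊤ with hP
    rw [Module.length_eq_add_of_exact P.subtype P.mkQ P.subtype_injective P.mkQ_surjective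
      (LinearMap.exact_subtype_mkQ P),
      Module.length_eq_add_of_exact (P.subtype.restrictScalars F) (P.mkQ.restrictScalars F)
      P.subtype_injective P.mkQ_surjective (LinearMap.exact_subtype_mkQ P), ih,
      length_eq_length_of_smul_eq_bot (F := F) p hp]
    · rw [← LinearMap.range_eq_top.mpr P.mkQ_surjective, LinearMap.range_eq_map,
        ← Submodule.map_smul'', ← hP, Submodule.mkQ_map_self]
    · apply Submodule.map_injective_of_injective P.subtype_injective
      rw [Submodule.map_smul'', Submodule.map_subtype_top, Submodule.map_bot, hP,
        ← Submodule.mul_smul, ← pow_succ, h]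

/-! ### Truncation of homogeneous ideals by powers of the variables -/

section Graded

variable {F : Type*} [Field F] {n : ℕ}

theorem homogeneousComponent_mul_of_isHomogeneous_one (f : MvPolynomial (Fin n) F)
    {y : MvPolynomial (Fin n) F} (hy : y.IsHomogeneous 1) (d : ℕ) :
    homogeneousComponent (d + 1) (f * y) = homogeneousComponent d f * y := by
  conv_lhs => rw [← sum_homogeneousComponent f, Finset.sum_mul, map_sum]
  have h : ∀ i, homogeneousComponent (d + 1) (homogeneousComponent i f * y) =
      if i = d then homogeneousComponent d f * y else 0 := by
    intro i
    rw [homogeneousComponent_of_mem ((homogeneousComponent_isHomogeneous i f).mul hy)]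
    by_cases hi : i = d
    · subst hi; simp
    · rw [if_neg hi, if_neg (by omega)]
  simp only [h]
  rw [Finset.sum_ite_eq']
  split_ifs with hd
  · rfl
  · rw [homogeneousComponent_eq_zero, zero_mul]
    simpa [Nat.lt_succ_iff] using hd

theorem homogeneousComponent_mem_pow_idealOfVars (f : MvPolynomial (Fin n) F) {D d : ℕ}
    (h : D ≤ d) : homogeneousComponent d f ∈ idealOfVars (Fin n) F ^ D := by
  rw [mem_pow_idealOfVars_iff']
  intro x hx
  rw [coeff_homogeneousComponent, if_neg (by omega)]

theorem isHomogeneous_one_mem_idealOfVars {y : MvPolynomial (Fin n) F} (hy : y.IsHomogeneous 1) :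
    y ∈ idealOfVars (Fin n) F := by
  rw [← pow_one (idealOfVars (Fin n) F), ← homogeneousComponent_eq_self hy]
  exact homogeneousComponent_mem_pow_idealOfVars _ le_rfl

variable {J : Ideal (MvPolynomial (Fin n) F)}
  (hJ : J.IsHomogeneous (homogeneousSubmodule (Fin n) F))

include hJ

theorem homogeneousComponent_mem_of_mem_sup {g : MvPolynomial (Fin n) F} {N d : ℕ} (hd : d < N)
    (hg : g ∈ J ⊔ idealOfVars (Fin n) F ^ N) : homogeneousComponent d g ∈ J := by
  obtain ⟨j, hj, h, hh, rfl⟩ := Submodule.mem_sup.mp hg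
  rw [map_add]
  have h0 : homogeneousComponent d h = 0 := by
    ext x
    rw [coeff_homogeneousComponent, coeff_zero]
    split_ifs with hx
    · exact (mem_pow_idealOfVars_iff' _ _).mp hh x (by omega)
    · rfl
  rw [h0, add_zero]
  exact homogeneousComponent_mem_of_mem hJ hj d

theorem mem_of_forall_mem_sup_pow {g : MvPolynomial (Fin n) F} (N₀ : ℕ)
    (hg : ∀ N, N₀ ≤ N → g ∈ J ⊔ idealOfVars (Fin n) F ^ N) : g ∈ J := by
  rw [mem_iff_homogeneousComponent_mem hJ]
  intro d
  exact homogeneousComponent_mem_of_mem_sup hJ (N := N₀ + d + 1) (by omega) (hg _ (by omega))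

/-- A linear form raises degree by exactly one, so below degree `D` the product with `y` is
unaffected by `m^(D+1)` and the test can be made component by component. -/
theorem colon_sup_pow_eq {y : MvPolynomial (Fin n) F} (hy : y.IsHomogeneous 1) (D : ℕ) :
    (J ⊔ idealOfVars (Fin n) F ^ (D + 1)).colon {y} =
      J.colon {y} ⊔ (J ⊔ idealOfVars (Fin n) F ^ D) := by
  apply le_antisymm
  · intro f hf
    rw [Submodule.mem_colon_singleton, smul_eq_mul] at hf
    rw [← sum_homogeneousComponent f]
    refine Ideal.sum_mem _ fun d _ => ?_
    by_cases hd : d < D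
    · apply Ideal.mem_sup_left
      rw [Submodule.mem_colon_singleton, smul_eq_mul,
        ← homogeneousComponent_mul_of_isHomogeneous_one f hy]
      exact homogeneousComponent_mem_of_mem_sup hJ (by omega) hf
    · exact Ideal.mem_sup_right (Ideal.mem_sup_right
        (homogeneousComponent_mem_pow_idealOfVars f (by omega)))
  · refine sup_le (Submodule.colon_mono le_sup_left le_rfl) (sup_le ?_ ?_)
    · exact le_sup_left.trans Ideal.le_colon
    · intro f hf
      rw [Submodule.mem_colon_singleton, smul_eq_mul, pow_succ]
      exact Ideal.mem_sup_right (Ideal.mul_mem_mul hf (isHomogeneous_one_mem_idealOfVars hy))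

/-- In terms of the Hilbert function `H` of `A = T / J` this says
`∑_{d < D} dim ker (y : A_d → A_{d+1}) = ∑_{d ≤ D} H_{A/yA}(d) - H_A(D)`. -/
theorem relLength_colon_add {y : MvPolynomial (Fin n) F} (hy : y.IsHomogeneous 1) (D : ℕ) :
    relLength (J ⊔ idealOfVars (Fin n) F ^ D) (J.colon {y}) +
      Module.length (MvPolynomial (Fin n) F)
        (MvPolynomial (Fin n) F ⧸ (J ⊔ idealOfVars (Fin n) F ^ (D + 1))) =
    Module.length (MvPolynomial (Fin n) F)
        (MvPolynomial (Fin n) F ⧸ (J ⊔ idealOfVars (Fin n) F ^ D)) +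
      Module.length (MvPolynomial (Fin n) F)
        (MvPolynomial (Fin n) F ⧸ ((J ⊔ Ideal.span {y}) ⊔ idealOfVars (Fin n) F ^ (D + 1))) := by
  have h1 := relLength_add_length_quotient (A := MvPolynomial (Fin n) F)
    (a := J ⊔ idealOfVars (Fin n) F ^ D)
    (b := J.colon {y} ⊔ (J ⊔ idealOfVars (Fin n) F ^ D)) le_sup_right
  have h2 := length_quotient_colon_add (J ⊔ idealOfVars (Fin n) F ^ (D + 1)) y
  rw [relLength_sup_right, ← colon_sup_pow_eq hJ hy] at h1
  rw [← h2, ← h1, sup_right_comm, add_assoc]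

omit hJ in
theorem relLength_sup_pow_le_colonLength (y : MvPolynomial (Fin n) F) (D : ℕ) :
    relLength (J ⊔ idealOfVars (Fin n) F ^ D) (J.colon {y}) ≤ colonLength J y :=
  relLength_anti_left le_sup_left _

omit hJ in
-- By the modular law, `(J + m^D) ∩ (J : y) = J + (m^D ∩ (J : y)) = J`.
theorem relLength_sup_pow_eq_colonLength {y : MvPolynomial (Fin n) F} {D : ℕ}
    (h : J.colon {y} ⊓ idealOfVars (Fin n) F ^ D ≤ J) :
    relLength (J ⊔ idealOfVars (Fin n) F ^ D) (J.colon {y}) = colonLength J y := by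
  rw [← relLength_inf_left, sup_inf_assoc_of_le _ (Ideal.le_colon : J ≤ _), inf_comm,
    sup_eq_left.mpr h, colonLength_eq_relLength]

/-- Constant lengths force `(J : y) ∩ m^D₀` into `J + m^N` for every `N ≥ D₀`, and these ideals
intersect in `J` because `J` is homogeneous. -/
theorem colon_inf_pow_le {y : MvPolynomial (Fin n) F} {D₀ : ℕ}
    (hfin : relLength (J ⊔ idealOfVars (Fin n) F ^ D₀) (J.colon {y}) ≠ ⊤)
    (h : ∀ D, D₀ ≤ D → relLength (J ⊔ idealOfVars (Fin n) F ^ D) (J.colon {y}) =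
      relLength (J ⊔ idealOfVars (Fin n) F ^ D₀) (J.colon {y})) :
    J.colon {y} ⊓ idealOfVars (Fin n) F ^ D₀ ≤ J := by
  rintro f ⟨hf1, hf2⟩
  refine mem_of_forall_mem_sup_pow hJ D₀ fun N hN => ?_
  exact inf_le_of_relLength_eq (sup_le_sup_left (Ideal.pow_le_pow_right hN) J) (h N hN)
    (by rwa [h N hN]) ⟨Ideal.mem_sup_right hf2, hf1⟩

end Graded

theorem isHomogeneous_map {A B : Type*} [CommRing A] [CommRing B] {n : ℕ} (φ : A →+* B)
    {J : Ideal (MvPolynomial (Fin n) A)} (hJ : J.IsHomogeneous (homogeneousSubmodule (Fin n) A)) :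
    (J.map (MvPolynomial.map φ)).IsHomogeneous (homogeneousSubmodule (Fin n) B) := by
  obtain ⟨s, rfl⟩ := (Ideal.IsHomogeneous.iff_exists _ _).mp hJ
  rw [Ideal.map_span]
  apply Ideal.homogeneous_span
  rintro _ ⟨_, ⟨⟨x, i, hx⟩, -, rfl⟩, rfl⟩
  exact ⟨i, MvPolynomial.IsHomogeneous.map hx φ⟩

section Truncation

variable {F : Type*} [Field F] {n : ℕ}

theorem length_quotient_eq_length (a : Ideal (MvPolynomial (Fin n) F)) (N : ℕ)
    (h : idealOfVars (Fin n) F ^ N ≤ a) :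
    Module.length (MvPolynomial (Fin n) F) (MvPolynomial (Fin n) F ⧸ a) =
      Module.length F (MvPolynomial (Fin n) F ⧸ a) := by
  refine length_eq_length_of_pow_smul_eq_bot (idealOfVars (Fin n) F) (fun t => ⟨coeff 0 t, ?_⟩) N ?_
  · rw [← pow_one (idealOfVars (Fin n) F), mem_pow_idealOfVars_iff']
    intro x hx
    have hx0 : x = 0 := (Finsupp.degree_eq_zero_iff x).mp (by omega)
    subst hx0
    simp
  · rw [eq_bot_iff, Submodule.smul_le]
    intro r hr x _
    obtain ⟨x, rfl⟩ := Submodule.mkQ_surjective a x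
    exact (Submodule.Quotient.mk_eq_zero a).mpr (Ideal.mul_mem_right _ _ (h hr))

end Truncation

/-! ### Rank of a matrix under specialization -/

section Rank

theorem exists_linearIndependent_rows {F m k : Type*} [Field F] [Fintype m] [Fintype k]
    (M : Matrix m k F) {r : ℕ} (hr : M.rank = r) :
    ∃ e : Fin r → m, LinearIndependent F (fun i => M (e i)) := by
  rw [Matrix.rank_eq_finrank_span_row] at hr
  subst hr
  obtain ⟨f, hf, -, hli⟩ := Submodule.exists_fun_fin_finrank_span_eq F (Set.range M.row)
  choose e he using hf
  refine ⟨e, ?_⟩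
  rwa [show (fun i => M (e i)) = f from funext he]

theorem exists_det_submatrix_ne_zero {F m k : Type*} [Field F] [Fintype m] [Fintype k]
    (M : Matrix m k F) :
    ∃ (e : Fin M.rank → m) (f : Fin M.rank → k), (M.submatrix e f).det ≠ 0 := by
  obtain ⟨e, he⟩ := exists_linearIndependent_rows M rfl
  have hr : (M.submatrix e id).transpose.rank = M.rank := by
    rw [Matrix.rank_transpose]
    have := LinearIndependent.rank_matrix (M := M.submatrix e id) he
    rwa [Fintype.card_fin] at this
  obtain ⟨f, hf⟩ := exists_linearIndependent_rows _ hr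
  refine ⟨e, f, ?_⟩
  have : IsUnit (M.submatrix e f) := by
    rw [← Matrix.linearIndependent_cols_iff_isUnit]
    exact hf
  exact ((Matrix.isUnit_iff_isUnit_det _).mp this).ne_zero

theorem le_rank_of_det_submatrix_ne_zero {F m k : Type*} [Field F] [Fintype k]
    (M : Matrix m k F) {r : ℕ} (e : Fin r → m) (f : Fin r → k)
    (h : (M.submatrix e f).det ≠ 0) : r ≤ M.rank := by
  have := Matrix.rank_of_det_ne_zero (A := M.submatrix e f) h
  rw [Fintype.card_fin] at this
  exact this.symm.le.trans (Matrix.rank_submatrix_le M e f)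

variable {B F L m k : Type*} [CommRing B] [Field F] [Field L] [Fintype m] [Fintype k]

/-- A minor nonzero after `φ` was nonzero in `B`, hence stays nonzero under the injective `ψ`. -/
theorem rank_map_le_rank_map (M : Matrix m k B) (φ : B →+* F) {ψ : B →+* L}
    (hψ : Function.Injective ψ) : (M.map φ).rank ≤ (M.map ψ).rank := by
  obtain ⟨e, f, h⟩ := exists_det_submatrix_ne_zero (M.map φ)
  refine le_rank_of_det_submatrix_ne_zero _ e f ?_
  rw [Matrix.submatrix_map] at h ⊢
  rw [← RingHom.mapMatrix_apply, ← RingHom.map_det] at h ⊢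
  exact (map_ne_zero_iff ψ hψ).mpr fun h0 => h (by rw [h0, map_zero])

theorem exists_rank_map_eq_rank_map (M : Matrix m k B) (F : Type*) [Field F] {ψ : B →+* L}
    (hψ : Function.Injective ψ) :
    ∃ δ : B, δ ≠ 0 ∧ ∀ φ : B →+* F, φ δ ≠ 0 → (M.map φ).rank = (M.map ψ).rank := by
  obtain ⟨e, f, h⟩ := exists_det_submatrix_ne_zero (M.map ψ)
  rw [Matrix.submatrix_map, ← RingHom.mapMatrix_apply, ← RingHom.map_det] at h
  refine ⟨(M.submatrix e f).det, fun h0 => h (by rw [h0, map_zero]), fun φ hφ => ?_⟩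
  refine le_antisymm (rank_map_le_rank_map M φ hψ) ?_
  refine le_rank_of_det_submatrix_ne_zero _ e f ?_
  rwa [Matrix.submatrix_map, ← RingHom.mapMatrix_apply, ← RingHom.map_det]

end Rank

/-! ### Truncated quotients as coranks of coefficient matrices -/

section Truncation

/-- The monomials of degree less than `D`. -/
abbrev MonomialsBelow (n D : ℕ) : Type := {α : Fin n →₀ ℕ // α.degree < D}

noncomputable instance (n D : ℕ) : Fintype (MonomialsBelow n D) :=
  (Finsupp.finite_of_degree_lt (σ := Fin n) D).fintype

/-- The rows are the coefficients, in degrees less than `D`, of the multiples `x^α g_j`. -/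
noncomputable def coeffMatrix {A ι : Type*} [CommRing A] {n : ℕ} (G : ι → MvPolynomial (Fin n) A)
    (D : ℕ) : Matrix (MonomialsBelow n D × ι) (MonomialsBelow n D) A :=
  Matrix.of fun p β => coeff β.1 (monomial p.1.1 1 * G p.2)

theorem coeffMatrix_map {A A' ι : Type*} [CommRing A] [CommRing A'] {n : ℕ} (φ : A →+* A')
    (G : ι → MvPolynomial (Fin n) A) (D : ℕ) :
    coeffMatrix (fun j => MvPolynomial.map φ (G j)) D = (coeffMatrix G D).map φ := by
  ext p β
  simp only [coeffMatrix, Matrix.of_apply, Matrix.map_apply, ← coeff_map, map_mul, map_monomial,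
    map_one]

variable {F ι : Type*} [Field F] {n : ℕ}

/-- The coefficients in degrees less than `D`. -/
noncomputable def coeffsBelow (F : Type*) [Field F] (n D : ℕ) :
    MvPolynomial (Fin n) F →ₗ[F] (MonomialsBelow n D → F) :=
  LinearMap.pi fun β => lcoeff F β.1

theorem ker_coeffsBelow (D : ℕ) : LinearMap.ker (coeffsBelow F n D) =
    (idealOfVars (Fin n) F ^ D).restrictScalars F := by
  ext f
  rw [LinearMap.mem_ker, Submodule.restrictScalars_mem, mem_pow_idealOfVars_iff', funext_iff]
  exact Subtype.forall

theorem coeffsBelow_surjective (D : ℕ) : Function.Surjective (coeffsBelow F n D) := by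
  intro v
  refine ⟨∑ β, monomial β.1 (v β), ?_⟩
  funext γ
  simp only [coeffsBelow, LinearMap.pi_apply, lcoeff_apply, coeff_sum, coeff_monomial]
  rw [Finset.sum_eq_single γ]
  · simp
  · intro β _ hβ
    rw [if_neg fun h => hβ (Subtype.ext h)]
  · simp

theorem comap_span_row_coeffMatrix (G : ι → MvPolynomial (Fin n) F) (D : ℕ) :
    (Submodule.span F (Set.range (coeffMatrix G D).row)).comap (coeffsBelow F n D) =
      (Ideal.span (Set.range G) ⊔ idealOfVars (Fin n) F ^ D).restrictScalars F := by
  have hrow : ∀ p, (coeffMatrix G D).row p = coeffsBelow F n D (monomial p.1.1 1 * G p.2) :=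
    fun p => rfl
  set W := Submodule.span F (Set.range (coeffMatrix G D).row) with hW
  have hmon : ∀ (α : Fin n →₀ ℕ) (r : F) (j : ι), coeffsBelow F n D (monomial α r * G j) ∈ W := by
    intro α r j
    by_cases hα : α.degree < D
    · have : (monomial α r : MvPolynomial (Fin n) F) = r • monomial α 1 := by
        rw [smul_monomial, smul_eq_mul, mul_one]
      rw [this, smul_mul_assoc, map_smul]
      exact W.smul_mem r (Submodule.subset_span ⟨(⟨α, hα⟩, j), rfl⟩)
    -- Multiples by monomials of degree at least `D` are not rows, but they vanish in the
    -- truncation.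
    · have : monomial α r * G j ∈ LinearMap.ker (coeffsBelow F n D) := by
        rw [ker_coeffsBelow, Submodule.restrictScalars_mem]
        refine Ideal.mul_mem_right _ _ ?_
        rw [mem_pow_idealOfVars_iff']
        intro x hx
        rw [coeff_monomial, if_neg]
        rintro rfl
        exact hα hx
      rw [LinearMap.mem_ker.mp this]
      exact W.zero_mem
  have hspan : ∀ g ∈ Ideal.span (Set.range G), ∀ t, coeffsBelow F n D (t * g) ∈ W := by
    intro g hg
    induction hg using Submodule.span_induction with
    | mem x hx =>
      obtain ⟨j, rfl⟩ := hx
      intro t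
      rw [t.as_sum, Finset.sum_mul, map_sum]
      exact W.sum_mem fun α _ => hmon α _ j
    | zero => intro t; rw [mul_zero, map_zero]; exact W.zero_mem
    | add x y _ _ hx hy => intro t; rw [mul_add, map_add]; exact W.add_mem (hx t) (hy t)
    | smul s x _ hx => intro t; rw [smul_eq_mul, ← mul_assoc]; exact hx _
  apply le_antisymm
  · intro f hf
    have hle : W ≤ ((Ideal.span (Set.range G)).restrictScalars F).map (coeffsBelow F n D) := by
      rw [hW, Submodule.span_le]
      rintro _ ⟨p, rfl⟩
      exact ⟨_, Ideal.mul_mem_left _ _ (Ideal.subset_span ⟨p.2, rfl⟩), (hrow p).symm⟩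
    obtain ⟨g, hg, hgf⟩ := hle hf
    have hker : f - g ∈ LinearMap.ker (coeffsBelow F n D) := by
      rw [LinearMap.mem_ker, map_sub, hgf, sub_self]
    rw [ker_coeffsBelow] at hker
    rw [← add_sub_cancel g f]
    exact Submodule.add_mem_sup hg hker
  · intro f hf
    obtain ⟨g, hg, h, hh, rfl⟩ := Submodule.mem_sup.mp hf
    have hh0 : coeffsBelow F n D h = 0 := by
      rw [← LinearMap.mem_ker, ker_coeffsBelow]; exact hh
    rw [Submodule.mem_comap, map_add, hh0, add_zero, ← one_mul g]
    exact hspan g hg 1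

theorem length_quotient_span_add_rank [Finite ι] (G : ι → MvPolynomial (Fin n) F) (D : ℕ) :
    Module.length (MvPolynomial (Fin n) F)
        (MvPolynomial (Fin n) F ⧸ (Ideal.span (Set.range G) ⊔ idealOfVars (Fin n) F ^ D)) +
      (coeffMatrix G D).rank = Fintype.card (MonomialsBelow n D) := by
  rw [length_quotient_eq_length _ D le_sup_right]
  set W := Submodule.span F (Set.range (coeffMatrix G D).row) with hW
  set a := Ideal.span (Set.range G) ⊔ idealOfVars (Fin n) F ^ D
  have hker : LinearMap.ker (W.mkQ ∘ₗ coeffsBelow F n D) = a.restrictScalars F := by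
    rw [LinearMap.ker_comp, Submodule.ker_mkQ]
    exact comap_span_row_coeffMatrix G D
  have e1 : (MvPolynomial (Fin n) F ⧸ a) ≃ₗ[F] ((MonomialsBelow n D → F) ⧸ W) :=
    (Submodule.Quotient.restrictScalarsEquiv F a).symm.trans
      ((Submodule.quotEquivOfEq _ _ hker.symm).trans
        (LinearMap.quotKerEquivOfSurjective _
          (W.mkQ_surjective.comp (coeffsBelow_surjective D))))
  rw [e1.length_eq, Module.length_eq_finrank, Matrix.rank_eq_finrank_span_row, ← hW,
    ← Nat.cast_add, Submodule.finrank_quotient_add_finrank, Module.finrank_fintype_fun_eq_card]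

end Truncation

/-! ### Semicontinuity of the truncated lengths -/

section Semicontinuity

theorem length_quotient_sup_pow_ne_top {F : Type*} [Field F] {n : ℕ}
    (a : Ideal (MvPolynomial (Fin n) F)) (D : ℕ) :
    Module.length (MvPolynomial (Fin n) F)
      (MvPolynomial (Fin n) F ⧸ (a ⊔ idealOfVars (Fin n) F ^ D)) ≠ ⊤ := by
  obtain ⟨m, g, rfl⟩ := Submodule.fg_iff_exists_fin_generating_family.mp
    (IsNoetherian.noetherian a)
  have h := length_quotient_span_add_rank g D
  intro htop
  rw [Ideal.span, htop, top_add] at h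
  exact ENat.natCast_ne_top _ h.symm

variable {B F L ι : Type*} [CommRing B] [Field F] [Field L] [Finite ι] {n : ℕ}

theorem length_quotient_span_le (G : ι → MvPolynomial (Fin n) B) (D : ℕ) (φ : B →+* F)
    {ψ : B →+* L} (hψ : Function.Injective ψ) :
    Module.length (MvPolynomial (Fin n) L) (MvPolynomial (Fin n) L ⧸
        (Ideal.span (Set.range fun j => map ψ (G j)) ⊔ idealOfVars (Fin n) L ^ D)) ≤
      Module.length (MvPolynomial (Fin n) F) (MvPolynomial (Fin n) F ⧸
        (Ideal.span (Set.range fun j => map φ (G j)) ⊔ idealOfVars (Fin n) F ^ D)) := by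
  have := Fintype.ofFinite ι
  have h1 := length_quotient_span_add_rank (fun j => map ψ (G j)) D
  have h2 := length_quotient_span_add_rank (fun j => map φ (G j)) D
  rw [coeffMatrix_map] at h1 h2
  have hle := rank_map_le_rank_map (coeffMatrix G D) φ hψ
  lift Module.length (MvPolynomial (Fin n) L) (MvPolynomial (Fin n) L ⧸
        (Ideal.span (Set.range fun j => map ψ (G j)) ⊔ idealOfVars (Fin n) L ^ D)) to ℕ
    using length_quotient_sup_pow_ne_top _ D with a
  lift Module.length (MvPolynomial (Fin n) F) (MvPolynomial (Fin n) F ⧸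
        (Ideal.span (Set.range fun j => map φ (G j)) ⊔ idealOfVars (Fin n) F ^ D)) to ℕ
    using length_quotient_sup_pow_ne_top _ D with b
  norm_cast at *
  omega

theorem exists_length_quotient_span_eq (G : ι → MvPolynomial (Fin n) B) (D : ℕ)
    (F : Type*) [Field F] {ψ : B →+* L} (hψ : Function.Injective ψ) :
    ∃ δ : B, δ ≠ 0 ∧ ∀ φ : B →+* F, φ δ ≠ 0 →
      Module.length (MvPolynomial (Fin n) L) (MvPolynomial (Fin n) L ⧸
        (Ideal.span (Set.range fun j => map ψ (G j)) ⊔ idealOfVars (Fin n) L ^ D)) =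
      Module.length (MvPolynomial (Fin n) F) (MvPolynomial (Fin n) F ⧸
        (Ideal.span (Set.range fun j => map φ (G j)) ⊔ idealOfVars (Fin n) F ^ D)) := by
  have := Fintype.ofFinite ι
  obtain ⟨δ, hδ, h⟩ := exists_rank_map_eq_rank_map (coeffMatrix G D) F hψ
  refine ⟨δ, hδ, fun φ hφ => ?_⟩
  have h1 := length_quotient_span_add_rank (fun j => map ψ (G j)) D
  have h2 := length_quotient_span_add_rank (fun j => map φ (G j)) D
  rw [coeffMatrix_map] at h1 h2
  rw [h φ hφ, ← h1] at h2
  exact ((WithTop.add_right_inj (ENat.natCast_ne_top _)).mp h2).symm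

/-- Field extension preserves these lengths: `θ` and the identity of `K` are both injective, so
semicontinuity applies in both directions. -/
theorem length_quotient_map_eq {K : Type*} [Field K] (I : Ideal (MvPolynomial (Fin n) K)) (D : ℕ)
    (θ : K →+* F) :
    Module.length (MvPolynomial (Fin n) F) (MvPolynomial (Fin n) F ⧸
        (I.map (map θ) ⊔ idealOfVars (Fin n) F ^ D)) =
      Module.length (MvPolynomial (Fin n) K) (MvPolynomial (Fin n) K ⧸
        (I ⊔ idealOfVars (Fin n) K ^ D)) := by
  obtain ⟨m, g, rfl⟩ := Submodule.fg_iff_exists_fin_generating_family.mp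
    (IsNoetherian.noetherian I)
  have h1 := length_quotient_span_le g D (RingHom.id K) θ.injective
  have h2 := length_quotient_span_le g D θ (RingHom.id K).injective
  have hg : (fun j => map (RingHom.id K) (g j)) = g := funext fun j => MvPolynomial.map_id (g j)
  rw [hg] at h1 h2
  change Module.length _ (_ ⧸ ((Ideal.span (Set.range g)).map (map θ) ⊔ _)) = _
  rw [Ideal.map_span, ← Set.range_comp]
  exact le_antisymm h1 h2

/-- The length, over `F[x]`, of the part of `(IF[x] : y) / IF[x]` in degrees less than `D`, where
`y` is the image of `Y` under a specialization `θ`. -/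
noncomputable def truncatedLength {K : Type*} [Field K] (I : Ideal (MvPolynomial (Fin n) K))
    (σ : K →+* B) (Y : MvPolynomial (Fin n) B) (D : ℕ) (θ : B →+* F) : ℕ∞ :=
  relLength (I.map (map (θ.comp σ)) ⊔ idealOfVars (Fin n) F ^ D)
    ((I.map (map (θ.comp σ))).colon {map θ Y})

variable {K : Type*} [Field K] {I : Ideal (MvPolynomial (Fin n) K)}
    (hI : I.IsHomogeneous (homogeneousSubmodule (Fin n) K)) (σ : K →+* B)
    {Y : MvPolynomial (Fin n) B} (hY : Y.IsHomogeneous 1)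

include hI hY

theorem truncatedLength_add (D : ℕ) (θ : B →+* F) :
    truncatedLength I σ Y D θ +
      Module.length (MvPolynomial (Fin n) K) (MvPolynomial (Fin n) K ⧸
        (I ⊔ idealOfVars (Fin n) K ^ (D + 1))) =
      Module.length (MvPolynomial (Fin n) K) (MvPolynomial (Fin n) K ⧸
        (I ⊔ idealOfVars (Fin n) K ^ D)) +
      Module.length (MvPolynomial (Fin n) F) (MvPolynomial (Fin n) F ⧸
        (I.map (map (θ.comp σ)) ⊔ Ideal.span {map θ Y} ⊔ idealOfVars (Fin n) F ^ (D + 1))) := by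
  rw [← length_quotient_map_eq I D (θ.comp σ), ← length_quotient_map_eq I (D + 1) (θ.comp σ)]
  exact relLength_colon_add (isHomogeneous_map _ hI) (hY.map θ) D

theorem truncatedLength_ne_top (D : ℕ) (θ : B →+* F) : truncatedLength I σ Y D θ ≠ ⊤ := by
  intro h
  have h1 := truncatedLength_add hI σ hY D θ
  rw [h, top_add] at h1
  exact WithTop.add_ne_top.mpr
    ⟨length_quotient_sup_pow_ne_top _ _, length_quotient_sup_pow_ne_top _ _⟩ h1.symm

omit hI hY in
theorem map_span_sup_span_singleton {m : ℕ} (g : Fin m → MvPolynomial (Fin n) K) (θ : B →+* F) :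
    (Ideal.span (Set.range g)).map (map (θ.comp σ)) ⊔ Ideal.span {map θ Y} =
      Ideal.span (Set.range fun o : Option (Fin m) =>
        map θ (o.elim Y fun j => map σ (g j))) := by
  rw [Ideal.map_span, ← Ideal.span_union, ← Set.range_comp]
  congr 1
  ext p
  simp [Option.exists, eq_comm, map_map]

theorem truncatedLength_le (D : ℕ) (φ : B →+* F) {ψ : B →+* L} (hψ : Function.Injective ψ) :
    truncatedLength I σ Y D ψ ≤ truncatedLength I σ Y D φ := by
  have h1 := truncatedLength_add hI σ hY D ψ
  have h2 := truncatedLength_add hI σ hY D φ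
  obtain ⟨m, g, hg⟩ := Submodule.fg_iff_exists_fin_generating_family.mp
    (IsNoetherian.noetherian I)
  refine (WithTop.add_le_add_iff_right (length_quotient_sup_pow_ne_top I (D + 1))).mp ?_
  refine (h1.trans_le ?_).trans h2.symm.le
  gcongr _ + ?_
  rw [← hg]
  change Module.length _ (_ ⧸ (Ideal.map _ (Ideal.span _) ⊔ _ ⊔ _)) ≤
    Module.length _ (_ ⧸ (Ideal.map _ (Ideal.span _) ⊔ _ ⊔ _))
  rw [map_span_sup_span_singleton σ g ψ, map_span_sup_span_singleton σ g φ]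
  exact length_quotient_span_le _ _ φ hψ

theorem exists_truncatedLength_eq (D : ℕ) (F : Type*) [Field F] {ψ : B →+* L}
    (hψ : Function.Injective ψ) : ∃ δ : B, δ ≠ 0 ∧ ∀ φ : B →+* F, φ δ ≠ 0 →
      truncatedLength I σ Y D ψ = truncatedLength I σ Y D φ := by
  obtain ⟨m, g, hg⟩ := Submodule.fg_iff_exists_fin_generating_family.mp
    (IsNoetherian.noetherian I)
  -- The level is `D + 1` because `y` enters `truncatedLength_add` only through the quotient by
  -- `m^(D+1)`.
  obtain ⟨δ, hδ, h⟩ := exists_length_quotient_span_eq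
    (fun o : Option (Fin m) => o.elim Y fun j => map σ (g j)) (D + 1) F hψ
  refine ⟨δ, hδ, fun φ hφ => ?_⟩
  have h1 := truncatedLength_add hI σ hY D ψ
  have h2 := truncatedLength_add hI σ hY D φ
  have h3 := h φ hφ
  rw [← map_span_sup_span_singleton σ g ψ, ← map_span_sup_span_singleton σ g φ] at h3
  change Ideal.span _ = _ at hg
  rw [hg] at h3
  refine (WithTop.add_right_inj (length_quotient_sup_pow_ne_top I (D + 1))).mp ?_
  exact h1.trans ((congrArg _ h3).trans h2.symm)

end Semicontinuity

/-! ### A uniform degree bound for general linear forms -/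

section GeneralLinearForm

variable {K : Type*} [Field K] {n : ℕ}

/-- The linear form with given coefficient vector, as a linear map. -/
noncomputable def linFormHom (K : Type*) [Field K] (n : ℕ) :
    (Fin n → K) →ₗ[K] MvPolynomial (Fin n) K where
  toFun := linForm
  map_add' a b := by simp [linForm, add_mul, Finset.sum_add_distrib]
  map_smul' c a := by
    simp [linForm, smul_eq_C_mul, Finset.mul_sum, mul_assoc]

theorem linForm_isHomogeneous (a : Fin n → K) : (linForm a : R K n).IsHomogeneous 1 := by
  refine IsHomogeneous.sum _ _ _ fun i _ => ?_
  simpa using (isHomogeneous_C (Fin n) (a i)).mul (isHomogeneous_X K i)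

theorem exists_eq_linForm {y : MvPolynomial (Fin n) K} (hy : y.IsHomogeneous 1) :
    ∃ a : Fin n → K, y = linForm a := by
  have h : y ∈ homogeneousSubmodule (Fin n) K 1 := hy
  rw [homogeneousSubmodule_one_eq_span_X, Submodule.mem_span_range_iff_exists_fun] at h
  obtain ⟨a, rfl⟩ := h
  exact ⟨a, by simp [linForm, smul_eq_C_mul]⟩

/-- Either `Q` contains a power of `m`, or the linear forms in the radical of `Q` form a proper
subspace. In the second case `δ` is the equation of a hyperplane containing it, and off that
hyperplane `linForm a` is a nonzerodivisor modulo `Q`, so `k = 0` works. -/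
theorem exists_ne_zero_of_isPrimary {Q : Ideal (MvPolynomial (Fin n) K)} (hQ : Q.IsPrimary) :
    ∃ δ : MvPolynomial (Fin n) K, δ ≠ 0 ∧ ∃ k : ℕ, ∀ a : Fin n → K, eval a δ ≠ 0 →
      Q.colon {linForm a} ⊓ idealOfVars (Fin n) K ^ k ≤ Q := by
  by_cases hm : idealOfVars (Fin n) K ≤ Q.radical
  · obtain ⟨k, hk⟩ := Ideal.exists_pow_le_of_le_radical_of_fg hm (idealOfVars_fg _ _)
    exact ⟨1, one_ne_zero, k, fun a _ => inf_le_right.trans hk⟩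
  · set p : Submodule K (Fin n → K) :=
      (Q.radical.restrictScalars K).comap (linFormHom K n) with hp
    have hmem : ∀ a, a ∈ p ↔ linForm a ∈ Q.radical := fun a => Iff.rfl
    have hlt : p < ⊤ := by
      rw [lt_top_iff_ne_top]
      intro htop
      apply hm
      rw [idealOfVars, Ideal.span_le]
      rintro _ ⟨i, rfl⟩
      have := (hmem (Pi.single i 1)).mp (htop ▸ Submodule.mem_top)
      simpa [linForm, Pi.single_apply] using this
    obtain ⟨f, hf, hpf⟩ := Submodule.exists_le_ker_of_lt_top p hlt
    have heval : ∀ a, eval a (linForm fun i => f (Pi.single i 1)) = f a := by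
      intro a
      conv_rhs => rw [pi_eq_sum_univ' a, map_sum]
      simp [linForm, mul_comm]
    refine ⟨linForm fun i => f (Pi.single i 1), fun h0 => hf ?_, 0, fun a ha => ?_⟩
    · ext i
      have := heval (Pi.single i 1)
      rw [h0, map_zero] at this
      simpa using this.symm
    · rw [heval] at ha
      rintro g ⟨hg, -⟩
      rw [SetLike.mem_coe, Submodule.mem_colon_singleton, smul_eq_mul] at hg
      refine ((Ideal.isPrimary_iff.mp hQ).2 hg).resolve_right fun h => ha ?_
      exact hpf ((hmem a).mpr h)

theorem exists_colon_linForm_inf_pow_le (I : Ideal (MvPolynomial (Fin n) K)) :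
    ∃ δ : MvPolynomial (Fin n) K, δ ≠ 0 ∧ ∃ k : ℕ, ∀ a : Fin n → K, eval a δ ≠ 0 →
      I.colon {linForm a} ⊓ idealOfVars (Fin n) K ^ k ≤ I := by
  obtain ⟨s, rfl, hs⟩ := Submodule.isLasker (MvPolynomial (Fin n) K) (MvPolynomial (Fin n) K) I
  induction s using Finset.cons_induction with
  | empty => exact ⟨1, one_ne_zero, 0, fun a _ => by simp⟩
  | cons Q s hQ ih =>
    obtain ⟨δ₁, h₁, k₁, H₁⟩ := exists_ne_zero_of_isPrimary (hs (Finset.mem_cons_self Q s))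
    obtain ⟨δ₂, h₂, k₂, H₂⟩ := ih fun J hJ => hs (Finset.mem_cons_of_mem hJ)
    refine ⟨δ₁ * δ₂, mul_ne_zero h₁ h₂, max k₁ k₂, fun a ha => ?_⟩
    rw [map_mul] at ha
    rw [Finset.inf_cons, id_eq, Submodule.inf_colon]
    refine le_inf (le_trans ?_ (H₁ a (left_ne_zero_of_mul ha)))
      (le_trans ?_ (H₂ a (right_ne_zero_of_mul ha)))
    · exact inf_le_inf inf_le_left (Ideal.pow_le_pow_right (le_max_left _ _))
    · exact inf_le_inf inf_le_right (Ideal.pow_le_pow_right (le_max_right _ _))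

end GeneralLinearForm

/-! ### `R'` as the localization of `K(X)[x]` at the variables -/

section GenericRing

variable (K : Type*) [Field K] (n : ℕ)

/-- The field `K(X₁, …, Xₙ)`. -/
abbrev GenericField : Type _ := FractionRing (MvPolynomial (Fin n) K)

/-- The inclusion of `K[x][X]` in `K(X)[x]`. -/
noncomputable def toGeneric : S K n →+* MvPolynomial (Fin n) (GenericField K n) :=
  (map (algebraMap (MvPolynomial (Fin n) K) (GenericField K n))).comp
    (commAlgEquiv K (Fin n) (Fin n)).toRingEquiv.toRingHom

theorem toGeneric_comp_C : (toGeneric K n).comp (C : R K n →+* S K n) =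
    map ((algebraMap (MvPolynomial (Fin n) K) (GenericField K n)).comp C) := by
  ext <;> simp [toGeneric]

instance isMaximal_idealOfVars (F : Type*) [Field F] : (idealOfVars (Fin n) F).IsMaximal := by
  have h : idealOfVars (Fin n) F = RingHom.ker (constantCoeff : MvPolynomial (Fin n) F →+* F) :=
    maxIdeal_eq_ker F n
  rw [h]
  exact RingHom.ker_isMaximal_of_surjective _ fun c => ⟨C c, constantCoeff_C _ c⟩

theorem comap_toGeneric_idealOfVars :
    (idealOfVars (Fin n) (GenericField K n)).comap (toGeneric K n) = maxIdealExt K n := by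
  have h : idealOfVars (Fin n) (GenericField K n) =
      RingHom.ker (constantCoeff : MvPolynomial (Fin n) (GenericField K n) →+* _) :=
    maxIdeal_eq_ker _ n
  have h2 : constantCoeff.comp (toGeneric K n) =
      (algebraMap (MvPolynomial (Fin n) K) (GenericField K n)).comp
        (map (constantCoeff : R K n →+* K)) := by
    ext <;> simp [toGeneric]
  rw [h, RingHom.comap_ker, h2, maxIdealExt, maxIdeal_eq_ker, ← ker_map]
  ext p
  simp [RingHom.mem_ker]

section

attribute [local instance] algebraMvPolynomial

/-- After exchange of the two sets of variables, `K(X)[x]` arises from `K[X][x]` by inverting the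
nonzero constants. -/
theorem exists_isLocalization_toGeneric :
    ∃ M : Submonoid (S K n), @IsLocalization _ _ M (MvPolynomial (Fin n) (GenericField K n)) _
      (toGeneric K n).toAlgebra := by
  have h := MvPolynomial.isLocalization (σ := Fin n)
    (nonZeroDivisors (MvPolynomial (Fin n) K)) (GenericField K n)
  exact ⟨_, IsLocalization.isLocalization_of_base_ringEquiv
    ((nonZeroDivisors (MvPolynomial (Fin n) K)).map (C (σ := Fin n))) _
    (commAlgEquiv K (Fin n) (Fin n)).toRingEquiv.symm⟩

end

/-- Localization in stages: `T` localizes `S`, and the ideal of the variables of `T` contracts to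
`𝔪S`, so both rings localize `S` at the same prime. -/
theorem exists_algebra_isLocalization :
    ∃ _ : Algebra (MvPolynomial (Fin n) (GenericField K n)) (R' K n),
      IsLocalization.AtPrime (R' K n) (idealOfVars (Fin n) (GenericField K n)) ∧
      (algebraMap (MvPolynomial (Fin n) (GenericField K n)) (R' K n)).comp (toGeneric K n) =
        algebraMap (S K n) (R' K n) := by
  let T := MvPolynomial (Fin n) (GenericField K n)
  let algST : Algebra (S K n) T := (toGeneric K n).toAlgebra
  obtain ⟨M, hM⟩ := exists_isLocalization_toGeneric K n
  let T' := Localization.AtPrime (idealOfVars (Fin n) (GenericField K n))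
  have hT' := IsLocalization.isLocalization_isLocalization_atPrime_isLocalization
    M T' (idealOfVars (Fin n) (GenericField K n))
  have hc : (idealOfVars (Fin n) (GenericField K n)).comap (algebraMap (S K n) T) =
    maxIdealExt K n := comap_toGeneric_idealOfVars K n
  have hT'' : IsLocalization (maxIdealExt K n).primeCompl T' := by
    have h : ((idealOfVars (Fin n) (GenericField K n)).comap (algebraMap (S K n) T)).primeCompl =
      (maxIdealExt K n).primeCompl := by
      ext x
      change (x ∉ _) ↔ (x ∉ _)
      rw [hc]
    rw [← h]
    exact hT'
  let E : T' ≃ₐ[S K n] R' K n := IsLocalization.algEquiv (maxIdealExt K n).primeCompl T' (R' K n)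
  let algTR : Algebra T (R' K n) := (E.toRingEquiv.toRingHom.comp (algebraMap T T')).toAlgebra
  refine ⟨algTR, ?_, ?_⟩
  · exact IsLocalization.isLocalization_of_algEquiv
      (idealOfVars (Fin n) (GenericField K n)).primeCompl
      (AlgEquiv.ofRingEquiv (R := T) (f := E.toRingEquiv) fun x => rfl)
  · exact RingHom.ext fun x => E.commutes x

end GenericRing

/-! ### Comparison of the generic form with its specializations -/

section Main

variable {K : Type*} [Field K] {n : ℕ}

/-- The generic linear form with coefficients in `K[X]`. -/
noncomputable def genericLinForm (K : Type*) [Field K] (n : ℕ) :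
    MvPolynomial (Fin n) (MvPolynomial (Fin n) K) :=
  ∑ i : Fin n, C (X i) * X i

theorem genericLinForm_isHomogeneous : (genericLinForm K n).IsHomogeneous 1 := by
  refine IsHomogeneous.sum _ _ _ fun i _ => ?_
  simpa using (isHomogeneous_C (Fin n) (X i)).mul (isHomogeneous_X (MvPolynomial (Fin n) K) i)

/-- The inclusion `K[X] → K(X)`. -/
noncomputable def toGenericField (K : Type*) [Field K] (n : ℕ) :
    MvPolynomial (Fin n) K →+* GenericField K n :=
  algebraMap _ _

theorem toGenericField_injective : Function.Injective (toGenericField K n) :=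
  IsFractionRing.injective (MvPolynomial (Fin n) K) (GenericField K n)

theorem map_eval_genericLinForm (a : Fin n → K) :
    map (eval a) (genericLinForm K n) = linForm a := by
  simp [genericLinForm, linForm]

theorem truncatedLength_eval (I : Ideal (MvPolynomial (Fin n) K)) (D : ℕ) (a : Fin n → K) :
    truncatedLength I C (genericLinForm K n) D (eval a) =
      relLength (I ⊔ idealOfVars (Fin n) K ^ D) (I.colon {linForm a}) := by
  have h1 : (eval a).comp C = RingHom.id K := by ext; simp
  have h2 : map (RingHom.id K) = RingHom.id (MvPolynomial (Fin n) K) := by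
    ext <;> simp
  rw [truncatedLength, map_eval_genericLinForm, h1, h2, Ideal.map_id]

theorem tValue_eq_colonLength (I : Ideal (MvPolynomial (Fin n) K)) (k : ℕ)
    (hk : (I.map (map ((toGenericField K n).comp C))).colon
        {map (toGenericField K n) (genericLinForm K n)} ⊓
      idealOfVars (Fin n) (GenericField K n) ^ k ≤ I.map (map ((toGenericField K n).comp C))) :
    tValue I = colonLength (I.map (map ((toGenericField K n).comp C)))
      (map (toGenericField K n) (genericLinForm K n)) := by
  obtain ⟨alg, hloc, hcomp⟩ := exists_algebra_isLocalization K n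
  have hI : extIdeal I = (I.map (map ((toGenericField K n).comp C))).map
      (algebraMap (MvPolynomial (Fin n) (GenericField K n)) (R' K n)) := by
    rw [extIdeal, ← hcomp, RingHom.comp_assoc, toGeneric_comp_C, ← Ideal.map_map]
    rfl
  have hY : genericForm K n = algebraMap (MvPolynomial (Fin n) (GenericField K n)) (R' K n)
      (map (toGenericField K n) (genericLinForm K n)) := by
    rw [genericForm, ← hcomp, RingHom.comp_apply]
    congr 1
    simp [genericLinForm, toGenericField, toGeneric]
  rw [tValue, hI, hY]
  refine colonLength_localization (idealOfVars (Fin n) (GenericField K n)) _ _ _ k ?_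
  exact (Ideal.mul_le_inf.trans (inf_comm _ _).le).trans hk

theorem exists_eval_ne_zero [Infinite K] {δ : MvPolynomial (Fin n) K} (hδ : δ ≠ 0) :
    ∃ a, eval a δ ≠ 0 := by
  by_contra! h
  exact hδ (MvPolynomial.funext fun a => by rw [h a, map_zero])

theorem exists_tValue_eq_truncatedLength [Infinite K] {I : Ideal (MvPolynomial (Fin n) K)}
    (hI : I.IsHomogeneous (homogeneousSubmodule (Fin n) K)) :
    ∃ δ : MvPolynomial (Fin n) K, δ ≠ 0 ∧ ∃ D : ℕ,
      tValue I = truncatedLength I C (genericLinForm K n) D (toGenericField K n) ∧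
      ∀ a, eval a δ ≠ 0 →
        truncatedLength I C (genericLinForm K n) D (eval a) = colonLength I (linForm a) := by
  obtain ⟨δ, hδ, D₀, h⟩ := exists_colon_linForm_inf_pow_le I
  have hstab : ∀ a, eval a δ ≠ 0 → ∀ D, D₀ ≤ D →
      truncatedLength I C (genericLinForm K n) D (eval a) = colonLength I (linForm a) := by
    intro a ha D hD
    rw [truncatedLength_eval]
    exact relLength_sup_pow_eq_colonLength
      ((inf_le_inf_left _ (Ideal.pow_le_pow_right hD)).trans (h a ha))
  refine ⟨δ, hδ, D₀, ?_, fun a ha => hstab a ha D₀ le_rfl⟩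
  have hY := genericLinForm_isHomogeneous (K := K) (n := n)
  have hle := colon_inf_pow_le (isHomogeneous_map ((toGenericField K n).comp C) hI)
    (truncatedLength_ne_top hI C hY D₀ (toGenericField K n)) (fun D hD => by
      obtain ⟨δ₁, h₁, H₁⟩ := exists_truncatedLength_eq hI C hY D K
        (toGenericField_injective (K := K) (n := n))
      obtain ⟨δ₂, h₂, H₂⟩ := exists_truncatedLength_eq hI C hY D₀ K
        (toGenericField_injective (K := K) (n := n))
      -- As `K` is infinite, one point `a` avoids all three hypersurfaces: there the special length
      -- is stable and agrees with the generic one at both `D` and `D₀`.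
      obtain ⟨a, ha⟩ := exists_eval_ne_zero (mul_ne_zero hδ (mul_ne_zero h₁ h₂))
      rw [map_mul, map_mul] at ha
      have ha0 := left_ne_zero_of_mul ha
      have ha1 := left_ne_zero_of_mul (right_ne_zero_of_mul ha)
      have ha2 := right_ne_zero_of_mul (right_ne_zero_of_mul ha)
      exact (H₁ _ ha1).trans ((hstab a ha0 D hD).trans
        ((hstab a ha0 D₀ le_rfl).symm.trans (H₂ _ ha2).symm)))
  rw [tValue_eq_colonLength I D₀ hle]
  exact (relLength_sup_pow_eq_colonLength hle).symm

theorem tValue_le_colonLength_and_general [Infinite K] {I : Ideal (MvPolynomial (Fin n) K)}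
    (hI : I.IsHomogeneous (homogeneousSubmodule (Fin n) K)) :
    tValue I ≠ ⊤ ∧ (∀ a, tValue I ≤ colonLength I (linForm a)) ∧
      ∃ δ : MvPolynomial (Fin n) K, δ ≠ 0 ∧
        ∀ a, eval a δ ≠ 0 → tValue I = colonLength I (linForm a) := by
  have hY := genericLinForm_isHomogeneous (K := K) (n := n)
  have hinj := toGenericField_injective (K := K) (n := n)
  obtain ⟨δ, hδ, D, h, hD⟩ := exists_tValue_eq_truncatedLength hI
  obtain ⟨ε, hε, H⟩ := exists_truncatedLength_eq hI C hY D K hinj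
  refine ⟨?_, fun a => ?_, δ * ε, mul_ne_zero hδ hε, fun a ha => ?_⟩
  · rw [h]
    exact truncatedLength_ne_top hI C hY D _
  · rw [h]
    -- The bound holds for every `a`: the special truncated length dominates the generic one, and
    -- truncation only shortens `(I : y)/I`.
    refine (truncatedLength_le hI C hY D (eval a) hinj).trans ?_
    rw [truncatedLength_eval]
    exact relLength_sup_pow_le_colonLength _ D
  · rw [map_mul] at ha
    rw [h, H _ (right_ne_zero_of_mul ha), hD a (left_ne_zero_of_mul ha)]

end Main

end TValue

theorem theorem3p1 {K : Type*} [Field K] [Infinite K] (n : ℕ)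
    (I : Ideal (MvPolynomial (Fin n) K))
    (hI : I.IsHomogeneous (MvPolynomial.homogeneousSubmodule (Fin n) K)) :
    TValue.colonLength (TValue.extIdeal I) (TValue.genericForm K n) ≠ ⊤ ∧
    (∀ y : MvPolynomial (Fin n) K, y.IsHomogeneous 1 →
      TValue.colonLength (TValue.extIdeal I) (TValue.genericForm K n) ≤
        TValue.colonLength I y) ∧
    TValue.ForGeneralLinearForm (fun y : MvPolynomial (Fin n) K =>
      TValue.colonLength (TValue.extIdeal I) (TValue.genericForm K n) =
        TValue.colonLength I y) ∧
    IsLeast {l : ℕ∞ | ∃ y : MvPolynomial (Fin n) K, y.IsHomogeneous 1 ∧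
      l = TValue.colonLength I y} (TValue.tValue I) := by
  obtain ⟨hfin, hle, δ, hδ, heq⟩ := TValue.tValue_le_colonLength_and_general hI
  have hle' : ∀ y : MvPolynomial (Fin n) K, y.IsHomogeneous 1 →
      TValue.tValue I ≤ TValue.colonLength I y := by
    intro y hy
    obtain ⟨a, rfl⟩ := TValue.exists_eq_linForm hy
    exact hle a
  obtain ⟨a, ha⟩ := TValue.exists_eval_ne_zero hδ
  refine ⟨hfin, hle', ⟨Ideal.span {δ}, ⟨a, fun h => ha ?_⟩, fun b hb => heq b fun h0 => hb ?_⟩,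
    ⟨TValue.linForm a, TValue.linForm_isHomogeneous a, heq a ha⟩, ?_⟩
  · simpa using MvPolynomial.mem_zeroLocus_iff.mp h δ (Ideal.mem_span_singleton_self δ)
  · rw [MvPolynomial.mem_zeroLocus_iff]
    intro p hp
    obtain ⟨q, rfl⟩ := Ideal.mem_span_singleton'.mp hp
    simp [h0]
  · rintro _ ⟨y, hy, rfl⟩
    exact hle' y hy
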